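/- Let $M$ be a set of $n$ men and $W$ a set of $n$ women, and let $\succ$ be a preference profile: each man has a strict total order over all women and each woman has a strict total order over all men. Write $\mathrm{DA}(\succ)$ for the matching computed by the men-proposing deferred acceptance algorithm, and let $\mu=\mathrm{DA}(\succ)$. Fix a man $m$ and write his list as $\succ_m=(L,\mu(m),R)$, where $L$ is the set of women ranked above $\mu(m)$ and $R$ the set of women ranked below $\mu(m)$. Let $X\subseteq R$ and $Y\subseteq L$. Let $\succ'_m$ be a list for $m$ obtained by pushing up $X$, i.e. a list of the form $(L\cup X,\ \mu(m),\ R\setminus X)$, and let $\succ''_m$ be a list for $m$ obtained by pushing up $X$ and pushing down $Y$, i.e. a list of the form $((L\cup X)\setminus Y,\ \mu(m),\ (R\setminus X)\cup Y)$; apart from this, the order of the women above $\mu(m)$ and of the women below $\mu(m)$ is arbitrary in both lists. Let $\mu'=\mathrm{DA}(\succ_{-m},\succ'_m)$ and $\mu''=\mathrm{DA}(\succ_{-m},\succ''_m)$. Suppose that at least one of the following holds: (a) both lists place the women of $X$ in the same way, i.e. for every $x\in X$ and every woman $a\in (L\cup X)\setminus Y$ one has $a\succ'_m x$ if and only if $a\succ''_m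 x$; (b) $m$ does not incur regret by pushing up $X$, i.e. $\mu'(m)=\mu(m)$ or $\mu'(m)\succ_m\mu(m)$. Then every woman $w\in W$ weakly prefers $\mu'$ to $\mu''$: $\mu'(w)\succ_w\mu''(w)$ or $\mu'(w)=\mu''(w)$. -/

import Mathlib

namespace StableMarriage

/-- A preference list over `α`: a strict total order, where `r.prefers a b` means that
`a` is ranked strictly above `b`. -/
structure PrefList (α : Type*) where
  prefers : α → α → Prop
  strictTotal : IsStrictTotalOrder α prefers

namespace PrefList

variable {α : Type*}

/-- `a` is ranked above `b`, or `a = b`. -/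
def weaklyPrefers (r : PrefList α) (a b : α) : Prop := r.prefers a b ∨ a = b

/-- The part of the list above `a`. -/
def above (r : PrefList α) (a : α) : Set α := {b | r.prefers b a}

/-- The part of the list below `a`. -/
def below (r : PrefList α) (a : α) : Set α := {b | r.prefers a b}

/-- `a` is the favourite element of `s`. -/
def IsFavourite (r : PrefList α) (s : Set α) (a : α) : Prop :=
  a ∈ s ∧ ∀ b ∈ s, r.weaklyPrefers a b

theorem irrefl (r : PrefList α) (a : α) : ¬ r.prefers a a :=
  r.strictTotal.irrefl a

theorem trans (r : PrefList α) {a b c : α} (h : r.prefers a b) (h' : r.prefers b c) :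
    r.prefers a c :=
  r.strictTotal.trans a b c h h'

theorem asymm (r : PrefList α) {a b : α} (h : r.prefers a b) : ¬ r.prefers b a :=
  fun h' => r.irrefl a (r.trans h h')

theorem total (r : PrefList α) (a b : α) : r.prefers a b ∨ a = b ∨ r.prefers b a := by
  by_contra! h
  exact h.2.1 (r.strictTotal.trichotomous a b h.1 h.2.2)

theorem IsFavourite.unique {r : PrefList α} {s : Set α} {a b : α}
    (ha : r.IsFavourite s a) (hb : r.IsFavourite s b) : a = b := by
  rcases ha.2 b hb.1 with h | h
  · rcases hb.2 a ha.1 with h' | h'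
    · exact absurd h' (r.asymm h)
    · exact h'.symm
  · exact h

theorem exists_isFavourite [Finite α] (r : PrefList α) {s : Set α} (hs : s.Nonempty) :
    ∃ a, r.IsFavourite s a := by
  have := r.strictTotal
  have wf : WellFounded r.prefers := Finite.wellFounded_of_trans_of_irrefl _
  obtain ⟨a, ha, hmin⟩ := wf.has_min s hs
  refine ⟨a, ha, fun b hb => ?_⟩
  rcases r.total a b with h | h | h
  · exact Or.inl h
  · exact Or.inr h
  · exact absurd h (hmin b hb)

end PrefList

/-- A preference profile: every man ranks all women and every woman ranks all men. -/
structure Profile (M W : Type*) where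
  men : M → PrefList W
  women : W → PrefList M

namespace Profile

variable {M W : Type*}

open Classical in
/-- The profile obtained when man `m` reports the list `r` and nobody else changes. -/
noncomputable def replaceMan (P : Profile M W) (m : M) (r : PrefList W) : Profile M W where
  men := Function.update P.men m r
  women := P.women

/-- `R` is the set of pairs `(m, w)` such that `w` has rejected `m` so far. In the proposal phase
the standing proposal of `m` is to his favourite woman among those who have not rejected him yet.
(A man who is tentatively accepted simply keeps his standing proposal.) -/
def Proposes (P : Profile M W) (R : Finset (M × W)) (m : M) (w : W) : Prop :=
  (P.men m).IsFavourite {w' | (m, w') ∉ R} w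

/-- In the rejection phase every woman keeps her favourite standing proposal and
rejects the others: `w` rejects `m`. -/
def Rejects (P : Profile M W) (R : Finset (M × W)) (m : M) (w : W) : Prop :=
  P.Proposes R m w ∧ ∃ m', P.Proposes R m' w ∧ (P.women w).prefers m' m

/-- All women weakly prefer `μ` to `μ'`.
A matching is a bijection `M ≃ W`. -/
def WomenWeaklyPrefer (P : Profile M W) (μ μ' : M ≃ W) : Prop :=
  ∀ w, (P.women w).weaklyPrefers (μ.symm w) (μ'.symm w)

variable [Fintype M] [Fintype W]

open Classical in
/-- One round of deferred acceptance: a proposal phase followed by a rejection phase. -/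
noncomputable def daRound (P : Profile M W) (R : Finset (M × W)) : Finset (M × W) :=
  R ∪ Finset.univ.filter fun p => P.Rejects R p.1 p.2

/-- The rejections made in the first `k` rounds. -/
noncomputable def daState (P : Profile M W) (k : ℕ) : Finset (M × W) :=
  P.daRound^[k] ∅

/-- The rejections at termination. Every round but the last makes a new rejection, so
`|M| * |W|` rounds suffice; see `daRound_daFinal`. -/
noncomputable def daFinal (P : Profile M W) : Finset (M × W) :=
  P.daState (Fintype.card (M × W))

theorem mem_daRound {P : Profile M W} {R : Finset (M × W)} {m : M} {w : W} :
    (m, w) ∈ P.daRound R ↔ (m, w) ∈ R ∨ P.Rejects R m w := by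
  simp [daRound]

theorem daState_succ (P : Profile M W) (k : ℕ) :
    P.daState (k + 1) = P.daRound (P.daState k) := by
  simp only [daState, Function.iterate_succ_apply']

/-- No further rejection, hence no further proposal, is made after `daFinal`. -/
theorem daRound_daFinal (P : Profile M W) : P.daRound P.daFinal = P.daFinal := by
  have key : ∀ k, P.daRound (P.daState k) = P.daState k ∨ k + 1 ≤ (P.daState (k + 1)).card := by
    intro k
    induction k with
    | zero =>
      by_cases h : P.daRound (P.daState 0) = P.daState 0
      · exact Or.inl h
      · right
        have : (P.daState 1).Nonempty := by
          rw [Finset.nonempty_iff_ne_empty]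
          intro h0
          apply h
          rw [← daState_succ, h0]
          rfl
        simpa using this.card_pos
    | succ k ih =>
      by_cases h : P.daRound (P.daState (k + 1)) = P.daState (k + 1)
      · exact Or.inl h
      · right
        rcases ih with ih | ih
        · exact absurd (by rw [daState_succ, ih, ih]) h
        · have hsub : P.daState (k + 1) ⊂ P.daState (k + 1 + 1) := by
            rw [daState_succ P (k + 1)]
            exact Finset.ssubset_iff_subset_ne.2
              ⟨by classical exact Finset.subset_union_left, fun h' => h h'.symm⟩
          have := Finset.card_lt_card hsub
          omega
  rcases key (Fintype.card (M × W)) with h | h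
  · exact h
  · have := Finset.card_le_univ (P.daState (Fintype.card (M × W) + 1))
    omega

/-- A woman who has rejected a man has a standing proposal from a man whom she prefers. -/
theorem exists_proposes_of_mem (P : Profile M W) (k : ℕ) :
    ∀ m w, (m, w) ∈ P.daState k →
      ∃ m', P.Proposes (P.daState k) m' w ∧ (P.women w).prefers m' m := by
  induction k with
  | zero => intro m w h; simp [daState] at h
  | succ k ih =>
    intro m w h
    obtain ⟨m', hm', hlt⟩ : ∃ m', P.Proposes (P.daState k) m' w ∧ (P.women w).prefers m' m := by
      rw [daState_succ, mem_daRound] at h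
      rcases h with h | h
      · exact ih m w h
      · exact h.2
    obtain ⟨b, hb, hbest⟩ := (P.women w).exists_isFavourite
      (s := {m' | P.Proposes (P.daState k) m' w}) ⟨m', hm'⟩
    refine ⟨b, ⟨?_, ?_⟩, ?_⟩
    · change (b, w) ∉ _
      rw [daState_succ, mem_daRound]
      rintro (h' | ⟨-, c, hc, hcb⟩)
      · exact hb.1 h'
      · rcases hbest c hc with h'' | h''
        · exact (P.women w).asymm hcb h''
        · exact (P.women w).irrefl c (h'' ▸ hcb)
    · intro w' hw'
      refine hb.2 w' fun h' => hw' ?_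
      rw [daState_succ, mem_daRound]
      exact Or.inl h'
    · rcases hbest m' hm' with h' | h'
      · exact (P.women w).trans h' hlt
      · exact h' ▸ hlt

theorem exists_proposes (P : Profile M W) (hcard : Fintype.card M = Fintype.card W) (m : M) :
    ∃ w, P.Proposes P.daFinal m w := by
  apply PrefList.exists_isFavourite
  by_contra hne
  have hall : ∀ w, (m, w) ∈ P.daFinal := by
    intro w
    by_contra h
    exact hne ⟨w, h⟩
  choose f hf using fun w => exists_proposes_of_mem P _ m w (hall w)
  have hinj : Function.Injective f := by
    intro w w' h
    have h1 := (hf w).1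
    rw [h] at h1
    exact h1.unique (hf w').1
  have hsurj := ((Fintype.bijective_iff_injective_and_card f).2 ⟨hinj, hcard.symm⟩).2
  obtain ⟨w, rfl⟩ := hsurj m
  exact (P.women w).irrefl _ (hf w).2

/-- The woman to whom `m` stands proposed when deferred acceptance terminates. -/
noncomputable def daPartner (P : Profile M W) (hcard : Fintype.card M = Fintype.card W) (m : M) :
    W :=
  (P.exists_proposes hcard m).choose

theorem daPartner_injective (P : Profile M W) (hcard : Fintype.card M = Fintype.card W) :
    Function.Injective (P.daPartner hcard) := by
  have hp : ∀ m, P.Proposes P.daFinal m (P.daPartner hcard m) :=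
    fun m => (P.exists_proposes hcard m).choose_spec
  have key : ∀ m m', P.daPartner hcard m = P.daPartner hcard m' →
      ¬ (P.women (P.daPartner hcard m)).prefers m' m := by
    intro m m' h hlt
    have hmem : (m, P.daPartner hcard m) ∈ P.daRound P.daFinal :=
      mem_daRound.2 (Or.inr ⟨hp m, m', h ▸ hp m', hlt⟩)
    rw [daRound_daFinal] at hmem
    exact (hp m).1 hmem
  intro m m' h
  rcases (P.women (P.daPartner hcard m)).total m m' with h' | h' | h'
  · exact absurd (h ▸ h') (key m' m h.symm)
  · exact h'
  · exact absurd h' (key m m' h)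

/-- The matching `DA(P)` computed by the men-proposing deferred acceptance algorithm. A matching
between equally many men and women is a bijection `μ : M ≃ W`; the partner of a
woman `w` is `μ.symm w`. -/
noncomputable def DA (P : Profile M W) (hcard : Fintype.card M = Fintype.card W) : M ≃ W :=
  Equiv.ofBijective (P.daPartner hcard)
    ((Fintype.bijective_iff_injective_and_card _).2 ⟨P.daPartner_injective hcard, hcard⟩)

end Profile

section Push

variable {W : Type*}

/-- `r'` results from the list `r = (L, p, R)` by pushing up the set `X`:
it has the form `(L ∪ X, p, R \ X)`. -/
def IsPushUp (r : PrefList W) (p : W) (X : Set W) (r' : PrefList W) : Prop :=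
  r'.above p = r.above p ∪ X ∧ r'.below p = r.below p \ X

/-- `r''` results from the list `r = (L, p, R)` by pushing up the set `X` and pushing down the
set `Y`: it has the form `((L ∪ X) \ Y, p, (R \ X) ∪ Y)`. -/
def IsPushUpDown (r : PrefList W) (p : W) (X Y : Set W) (r'' : PrefList W) : Prop :=
  r''.above p = (r.above p ∪ X) \ Y ∧ r''.below p = (r.below p \ X) ∪ Y

/-- The lists `r'` and `r''` place the women of `X` in the same way: every `x ∈ X` is ranked in
the same way in both lists relative to all women who are above `p` in both lists. -/
def SamePlacement (p : W) (X : Set W) (r' r'' : PrefList W) : Prop :=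
  ∀ x ∈ X, ∀ a ∈ r'.above p ∩ r''.above p, r'.prefers a x ↔ r''.prefers a x

end Push

end StableMarriage

namespace StableMarriage

namespace PrefList

variable {α : Type*}

/-! Put `p = μ(m)` and `q = μ'(m)`. If every woman above `q` in `r''` is already above `q` in `r'`,
then `μ'` stays stable under `r''`. Deferred acceptance returns the stable matching worst for all
women, so they weakly prefer `μ'` to `μ''` (`womenWeaklyPrefer_replaceMan`). It remains to locate
`q`. Strategy-proofness, obtained from the blocking lemma `exists_blocking_pair`, gives `q = p` or
`q ∈ X`. If `q = p`, the inclusion is `(L ∪ X) \ Y ⊆ L ∪ X`. If `q ∈ X`, it follows from (a). Under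
(b), only `q = p` is possible. -/

theorem prefers_of_weaklyPrefers_of_ne {r : PrefList α} {a b : α} (h : r.weaklyPrefers a b)
    (hne : a ≠ b) : r.prefers a b :=
  h.resolve_right hne

theorem not_prefers_of_weaklyPrefers {r : PrefList α} {a b : α} (h : r.weaklyPrefers a b) :
    ¬ r.prefers b a := by
  rintro h'
  rcases h with h | rfl
  · exact r.asymm h h'
  · exact r.irrefl _ h'

theorem weaklyPrefers_of_not_prefers {r : PrefList α} {a b : α} (h : ¬ r.prefers b a) :
    r.weaklyPrefers a b := by
  rcases r.total a b with h' | h' | h'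
  · exact Or.inl h'
  · exact Or.inr h'
  · exact absurd h' h

end PrefList

/-! ### Stable matchings and deferred acceptance -/

namespace Profile

variable {M W : Type*}

/-- A matching is stable if it has no blocking pair. -/
def Stable (P : Profile M W) (ν : M ≃ W) : Prop :=
  ∀ m w, (P.men m).prefers w (ν m) → ¬ (P.women w).prefers m (ν.symm w)

@[simp]
theorem replaceMan_men_self (P : Profile M W) (m : M) (r : PrefList W) :
    (P.replaceMan m r).men m = r := by
  simp [replaceMan]

theorem replaceMan_men_of_ne (P : Profile M W) {m a : M} (r : PrefList W) (h : a ≠ m) :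
    (P.replaceMan m r).men a = P.men a := by
  simp [replaceMan, h]

@[simp]
theorem replaceMan_replaceMan_self (P : Profile M W) (m : M) (r : PrefList W) :
    (P.replaceMan m r).replaceMan m (P.men m) = P := by
  simp [replaceMan]

/-- A stable matching remains stable if one man changes his list so that no woman moves above
his partner. -/
theorem Stable.replaceMan {P : Profile M W} {ν : M ≃ W} (h : P.Stable ν) {m : M} {r : PrefList W}
    (hr : r.above (ν m) ⊆ (P.men m).above (ν m)) : (P.replaceMan m r).Stable ν := by
  intro a w haw
  by_cases ha : a = m
  · subst ha
    rw [replaceMan_men_self] at haw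
    exact h a w (hr haw)
  · rw [replaceMan_men_of_ne P r ha] at haw
    exact h a w haw

variable [Fintype M] [Fintype W]

theorem daState_mono (P : Profile M W) : Monotone P.daState := by
  refine monotone_nat_of_le_succ fun k p hp => ?_
  rw [daState_succ]
  exact mem_daRound.2 (Or.inl hp)

/-- The partner of a man in a stable matching never rejects him. -/
theorem Stable.notMem_daState {P : Profile M W} {ν : M ≃ W} (h : P.Stable ν) (k : ℕ) :
    ∀ m, (m, ν m) ∉ P.daState k := by
  induction k with
  | zero => intro m hm; simp [daState] at hm
  | succ k ih =>
    intro m hm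
    rw [daState_succ, mem_daRound] at hm
    rcases hm with hm | ⟨-, m', hm', hlt⟩
    · exact ih m hm
    -- By induction `ν m'` has not rejected `m'`, so his proposal to `ν m` shows that `(m', ν m)`
    -- blocks `ν`.
    · have hne : ν m ≠ ν m' := fun heq => by
        rw [ν.injective heq] at hlt
        exact (P.women _).irrefl _ hlt
      exact h m' (ν m) (PrefList.prefers_of_weaklyPrefers_of_ne (hm'.2 _ (ih m')) hne)
        (by simpa using hlt)

variable (P : Profile M W) (hcard : Fintype.card M = Fintype.card W)

theorem proposes_DA (m : M) : P.Proposes P.daFinal m (P.DA hcard m) :=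
  (P.exists_proposes hcard m).choose_spec

theorem mem_daFinal_of_prefers {m : M} {w : W} (h : (P.men m).prefers w (P.DA hcard m)) :
    (m, w) ∈ P.daFinal := by
  by_contra hn
  exact PrefList.not_prefers_of_weaklyPrefers ((P.proposes_DA hcard m).2 w hn) h

theorem prefers_DA_symm_of_mem_daFinal {m : M} {w : W} (h : (m, w) ∈ P.daFinal) :
    (P.women w).prefers ((P.DA hcard).symm w) m := by
  obtain ⟨m', hm', hlt⟩ := exists_proposes_of_mem P _ m w h
  have : (P.DA hcard) m' = w := (P.proposes_DA hcard m').unique hm'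
  rwa [← this, Equiv.symm_apply_apply, this]

/-- Any woman a man ranks above his partner has rejected him, and her tentative partner only
improves afterwards. -/
theorem stable_DA : P.Stable (P.DA hcard) := fun _ _ hlt =>
  (P.women _).asymm (P.prefers_DA_symm_of_mem_daFinal hcard (P.mem_daFinal_of_prefers hcard hlt))

variable {P} in
/-- Deferred acceptance yields the stable matching that is worst for every woman. -/
theorem Stable.womenWeaklyPrefer_DA {ν : M ≃ W} (h : P.Stable ν) :
    P.WomenWeaklyPrefer ν (P.DA hcard) := by
  intro w
  refine PrefList.weaklyPrefers_of_not_prefers fun hlt => ?_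
  set a := (P.DA hcard).symm w with ha
  have haw : P.DA hcard a = w := by simp [ha]
  have hne : w ≠ ν a := by
    rintro heq
    rw [heq, Equiv.symm_apply_apply] at hlt
    exact (P.women _).irrefl _ hlt
  have hle := (P.proposes_DA hcard a).2 (ν a) (h.notMem_daState _ a)
  rw [haw] at hle
  exact h a w (PrefList.prefers_of_weaklyPrefers_of_ne hle hne) hlt

/-! ### The blocking lemma and strategy-proofness -/

/-- The blocking lemma of Gale and Sotomayor: if some man prefers the matching `ν` to the outcome
of deferred acceptance, then `ν` is blocked by a pair whose man does not. -/
theorem exists_blocking_pair {ν : M ≃ W}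
    (hS : ∃ s, (P.men s).prefers (ν s) (P.DA hcard s)) :
    ∃ m w, ¬ (P.men m).prefers (ν m) (P.DA hcard m) ∧
      (P.men m).prefers w (ν m) ∧ (P.women w).prefers m (ν.symm w) := by
  set μ := P.DA hcard with hμ
  -- If the `μ`-partner of some `ν s` does not prefer `ν`, he blocks `ν` with `ν s`: she rejected
  -- `s` and ended with someone better.
  by_cases hcase : ∃ s, (P.men s).prefers (ν s) (μ s) ∧
      ¬ (P.men (μ.symm (ν s))).prefers (ν (μ.symm (ν s))) (μ (μ.symm (ν s)))
  · obtain ⟨s, hs, hns⟩ := hcase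
    have hlt := P.prefers_DA_symm_of_mem_daFinal hcard (P.mem_daFinal_of_prefers hcard hs)
    rw [← hμ] at hlt
    refine ⟨μ.symm (ν s), ν s, hns, ?_, by simpa using hlt⟩
    rw [Equiv.apply_symm_apply] at hns
    refine PrefList.prefers_of_weaklyPrefers_of_ne (PrefList.weaklyPrefers_of_not_prefers hns) ?_
    intro heq
    rw [← ν.injective heq] at hlt
    exact (P.women _).irrefl _ hlt
  push Not at hcase
  set S : Set M := {s | (P.men s).prefers (ν s) (μ s)}
  -- `μ` and `ν` match `S` to the same women.
  have hsurj : ∀ s ∈ S, ν.symm (μ s) ∈ S := by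
    have hmaps : Set.MapsTo (fun s => μ.symm (ν s)) S S := fun s hs => hcase s hs
    have hinj : Set.InjOn (fun s => μ.symm (ν s)) S :=
      (μ.symm.injective.comp ν.injective).injOn
    intro s hs
    obtain ⟨t, ht, hts⟩ :=
      ((Set.toFinite S).injOn_iff_bijOn_of_mapsTo hmaps).1 hinj |>.surjOn hs
    have : ν t = μ s := by simpa using congrArg μ hts
    rwa [← this, Equiv.symm_apply_apply]
  -- The first state after which no man in `S` is rejected.
  have hex : ∃ k, ∀ s ∈ S, ∀ w, (s, w) ∈ P.daFinal → (s, w) ∈ P.daState k :=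
    ⟨_, fun _ _ _ h => h⟩
  classical
  obtain ⟨k, hkN, hk, hmin⟩ : ∃ k ≤ Fintype.card (M × W),
      (∀ s ∈ S, ∀ w, (s, w) ∈ P.daFinal → (s, w) ∈ P.daState k) ∧
      ∀ j < k, ¬ ∀ s ∈ S, ∀ w, (s, w) ∈ P.daFinal → (s, w) ∈ P.daState j :=
    ⟨Nat.find hex, Nat.find_min' hex fun _ _ _ h => h, Nat.find_spec hex,
      fun j hj => Nat.find_min hex hj⟩
  cases k with
  | zero =>
    -- Each man in `S` is rejected by his `ν`-partner, so some rejection has to occur.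
    obtain ⟨s, hs⟩ := hS
    simpa [daState] using hk s hs _ (P.mem_daFinal_of_prefers hcard hs)
  | succ j =>
    have hlast := hmin j j.lt_succ_self
    push Not at hlast
    obtain ⟨s, hs, w₀, hmem, hnot⟩ := hlast
    have hrej : P.Rejects (P.daState j) s w₀ := by
      have := hk s hs w₀ hmem
      rw [daState_succ, mem_daRound] at this
      exact this.resolve_left hnot
    set w := μ s
    have hs' := hsurj s hs
    set s' := ν.symm w with hs'def
    have hνs' : ν s' = w := by simp [hs'def]
    -- `s'` prefers `w = ν s'` to `μ s'`, so `w` rejects him, and no later than the last rejection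
    -- within `S`.
    have hrej' : (s', w) ∈ P.daState (j + 1) := by
      refine hk s' hs' w (P.mem_daFinal_of_prefers hcard ?_)
      have : (P.men s').prefers (ν s') (μ s') := hs'
      rwa [hνs'] at this
    obtain ⟨a, ha, hlt⟩ : ∃ a, P.Proposes (P.daState j) a w ∧ (P.women w).prefers a s' := by
      rw [daState_succ, mem_daRound] at hrej'
      rcases hrej' with h | h
      · exact exists_proposes_of_mem P j s' w h
      · exact h.2
    -- The best standing proposal at `w` survives the last rejection.
    obtain ⟨b, hb, hbest⟩ := (P.women w).exists_isFavourite
      (s := {c | P.Proposes (P.daState j) c w}) ⟨a, ha⟩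
    have hbs' : (P.women w).prefers b s' := by
      rcases hbest a ha with h | h
      · exact (P.women w).trans h hlt
      · exact h ▸ hlt
    have hbnot : (b, w) ∉ P.daState (j + 1) := by
      rw [daState_succ, mem_daRound]
      rintro (h | ⟨-, c, hc, hcb⟩)
      · exact hb.1 h
      · exact PrefList.not_prefers_of_weaklyPrefers (hbest c hc) hcb
    have hbμ : (P.men b).weaklyPrefers w (μ b) :=
      hb.2 _ fun h => (P.proposes_DA hcard b).1 (P.daState_mono (by omega) h)
    -- A man of `S` not rejected by `w` by now never will be, so `b ∈ S` would give `w = μ b` and `b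
    -- = s`. But `s` is just being rejected by the woman he proposes to.
    have hbS : b ∉ S := by
      intro hbS
      have hbw : w = μ b := by
        by_contra hne
        exact hbnot (hk b hbS w
          (P.mem_daFinal_of_prefers hcard (PrefList.prefers_of_weaklyPrefers_of_ne hbμ hne)))
      have hbs : s = b := μ.injective hbw
      subst hbs
      rw [← hb.unique hrej.1] at hmem
      exact (P.proposes_DA hcard s).1 hmem
    refine ⟨b, w, hbS, ?_, hbs'⟩
    have hne : w ≠ ν b := by
      intro heq
      have : b = s' := by simp [hs'def, heq]
      exact (P.women w).irrefl _ (this ▸ hbs')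
    refine PrefList.prefers_of_weaklyPrefers_of_ne ?_ hne
    rcases PrefList.weaklyPrefers_of_not_prefers hbS with h | h
    · rcases hbμ with h' | h'
      · exact Or.inl ((P.men b).trans h' h)
      · exact Or.inl (h' ▸ h)
    · exact h ▸ hbμ

/-- No man gains by misreporting his list to deferred acceptance. -/
theorem weaklyPrefers_DA_replaceMan (m : M) (r : PrefList W) :
    (P.men m).weaklyPrefers (P.DA hcard m) ((P.replaceMan m r).DA hcard m) := by
  refine PrefList.weaklyPrefers_of_not_prefers fun hlt => ?_
  obtain ⟨a, w, ha, haw, hwa⟩ := P.exists_blocking_pair hcard ⟨m, hlt⟩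
  -- The blocking man is not `m`, so his list is the same in both profiles and the pair contradicts
  -- stability under the misreport.
  have hne : a ≠ m := by
    rintro rfl
    exact ha hlt
  refine (P.replaceMan m r).stable_DA hcard a w ?_ hwa
  rwa [replaceMan_men_of_ne P r hne]

/-! ### Pushing women up and down -/

/-- After pushing up `X`, a man is matched to his original partner or to a woman in `X`. -/
theorem DA_pushUp_mem {m : M} {X : Set W} {r' : PrefList W}
    (hr' : IsPushUp (P.men m) (P.DA hcard m) X r') :
    (P.replaceMan m r').DA hcard m = P.DA hcard m ∨ (P.replaceMan m r').DA hcard m ∈ X := by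
  -- Strategy-proofness is used twice, with each of the two lists in turn as the true one.
  have h₁ := P.weaklyPrefers_DA_replaceMan hcard m r'
  have h₂ := (P.replaceMan m r').weaklyPrefers_DA_replaceMan hcard m (P.men m)
  rw [replaceMan_replaceMan_self, replaceMan_men_self] at h₂
  rcases h₂ with h₂ | h₂
  · have : (P.replaceMan m r').DA hcard m ∈ r'.above (P.DA hcard m) := h₂
    rw [hr'.1] at this
    exact Or.inr (this.resolve_left (PrefList.not_prefers_of_weaklyPrefers h₁))
  · exact Or.inl h₂

/-- If no woman is above the man's partner in `r''` who was not already above her in `r'`, then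
every woman weakly prefers the outcome under `r'` to the outcome under `r''`. -/
theorem womenWeaklyPrefer_replaceMan {m : M} {r' r'' : PrefList W}
    (h : r''.above ((P.replaceMan m r').DA hcard m) ⊆
      r'.above ((P.replaceMan m r').DA hcard m)) :
    P.WomenWeaklyPrefer ((P.replaceMan m r').DA hcard) ((P.replaceMan m r'').DA hcard) := by
  have hst := ((P.replaceMan m r').stable_DA hcard).replaceMan (m := m) (r := r'')
    (by rwa [replaceMan_men_self])
  have heq : (P.replaceMan m r').replaceMan m r'' = P.replaceMan m r'' := by simp [replaceMan]
  rw [heq] at hst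
  exact hst.womenWeaklyPrefer_DA hcard

end Profile

end StableMarriage

theorem mainTheorem10 {M W : Type*} [Fintype M] [Fintype W]
    (hcard : Fintype.card M = Fintype.card W)
    (P : StableMarriage.Profile M W) (m : M) (X Y : Set W)
    (hX : X ⊆ (P.men m).below (P.DA hcard m))
    (hY : Y ⊆ (P.men m).above (P.DA hcard m))
    (r' r'' : StableMarriage.PrefList W)
    (hr' : StableMarriage.IsPushUp (P.men m) (P.DA hcard m) X r')
    (hr'' : StableMarriage.IsPushUpDown (P.men m) (P.DA hcard m) X Y r'') :
    (StableMarriage.SamePlacement (P.DA hcard m) X r' r'' →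
      P.WomenWeaklyPrefer ((P.replaceMan m r').DA hcard) ((P.replaceMan m r'').DA hcard)) ∧
    ((P.men m).weaklyPrefers ((P.replaceMan m r').DA hcard m) (P.DA hcard m) →
      P.WomenWeaklyPrefer ((P.replaceMan m r').DA hcard) ((P.replaceMan m r'').DA hcard)) := by
  have heq : (P.replaceMan m r').DA hcard m = P.DA hcard m →
      P.WomenWeaklyPrefer ((P.replaceMan m r').DA hcard) ((P.replaceMan m r'').DA hcard) := by
    intro h
    apply P.womenWeaklyPrefer_replaceMan hcard
    rw [h, hr'.1, hr''.1]
    exact Set.sdiff_subset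
  refine ⟨fun hplace => ?_, fun hb => ?_⟩
  · rcases P.DA_pushUp_mem hcard hr' with h | hq
    · exact heq h
    · apply P.womenWeaklyPrefer_replaceMan hcard
      intro a ha
      -- `X` lies below `p` and `Y` above, so `q ∈ X` is not pushed down. Women above `q` in `r''`
      -- are thus above `p` in both lists, where (a) applies.
      have hqp : (P.replaceMan m r').DA hcard m ∈ r''.above (P.DA hcard m) := by
        rw [hr''.1]
        exact ⟨Or.inr hq, fun hqY => (P.men m).asymm (hX hq) (hY hqY)⟩
      have hap : a ∈ r''.above (P.DA hcard m) := r''.trans ha hqp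
      refine (hplace _ hq a ⟨?_, hap⟩).2 ha
      rw [hr''.1] at hap
      rw [hr'.1]
      exact hap.1
  -- Strategy-proofness excludes a strict gain, so absence of regret means equality.
  · refine heq (hb.resolve_left ?_)
    exact StableMarriage.PrefList.not_prefers_of_weaklyPrefers
      (P.weaklyPrefers_DA_replaceMan hcard m r')
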